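/- **Linked bandits.** There are $n\ge 2$ arms in a fixed order with unknown means $\mu=(\mu_1,\dots,\mu_n)\in[0,1]^n$. In each play the agent selects a subsequence $i_1<\dots<i_k$ of the arms; independent Bernoulli rewards $x_{i_1},\dots,x_{i_k}$ with means $\mu_{i_1},\dots,\mu_{i_k}$ are generated (independently of the past), and the agent observes only the prefix of the rewards up to and including the first reward $1$ (the whole sequence if all rewards are $0$). A (possibly randomized) policy decides, on the basis of the plays made so far and their feedback, either on the next subsequence to be played or to stop and declare an arm. Let $T\in\{0,1,2,\dots\}\cup\{\infty\}$ be the total number of plays and $\mathbb E_\mu[T]$ its expectation under $\mu$. Arm $i^*$ is the best arm of $\mu$ if $\mu_i<\mu_{i^*}$ for all $i\ne i^*$; then write $\mu^*=\mu_{i^*}$, $\Delta_i=\mu^*-\mu_i$, $\Delta=\min_{i\ne i^*}\Delta_i$ and $p=\prod_{i=1}^n(1-\mu_i)$. A policy identifies the best arm with probability at least $1-\delta$ for all mean rewards if, for every $\mu\in[0,1]^n$ that has a best arm $i^*$, with probability at least $1-\delta$ under $\mu$ it stops and declares $i^*$. **Corollary (lower bound).** For every $p_0>0$ and every $\delta_0<1/2$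 there is a constant $c>0$, depending only on $p_0$ and $\delta_0$, such that for every $n\ge2$, every $\delta\in(0,\delta_0]$, every policy for $n$ arms that identifies the best arm with probability at least $1-\delta$ for all mean rewards, and every $\mu\in[0,1]^n$ that has a best arm $i^*$ with $p_0\le\mu^*\le 1-p_0$, $$\mathbb E_\mu[T]\;\ge\; c\left(\sum_{i\ne i^*}\frac{\mu_i}{\Delta_i^2}+\frac{\mu^*+p}{\Delta^2}\right)\log\frac1\delta .$$ -/

import Mathlib

open MeasureTheory ProbabilityTheory
open scoped ENNReal

noncomputable section

namespace LinkedBandit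

/-- Mean rewards of the `n` arms, each in `[0, 1]`. -/
abbrev Means (n : ℕ) : Type := Fin n → unitInterval

/-- The distribution of a Bernoulli reward with mean `q` (`true` is the reward `1`). -/
def reward (q : unitInterval) : PMF Bool :=
  (bernoulliMeasure true false q).toPMF

/-- Independent Bernoulli rewards of the arms in a given list of arms. -/
def rewards {n : ℕ} (μ : Means n) : List (Fin n) → PMF (List Bool)
  | [] => PMF.pure []
  | i :: l => (reward (μ i)).bind fun x => (rewards μ l).map fun xs => x :: xs

/-- The part of a sequence of rewards that is revealed: the prefix up to and including the first
reward `1`, and the whole sequence if there is no reward `1`. -/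
def revealed : List Bool → List Bool
  | [] => []
  | true :: _ => [true]
  | false :: l => false :: revealed l

/-- The law of the feedback of one play of the subsequence of arms with index set `S`
(taken in increasing order). -/
def feedback {n : ℕ} (μ : Means n) (S : Finset (Fin n)) : PMF (List Bool) :=
  (rewards μ (S.sort (· ≤ ·))).map revealed

/-- A play as recorded by the agent: the selected subsequence and the feedback. -/
abbrev Play (n : ℕ) : Type := Finset (Fin n) × List Bool

/-- A (possibly randomized) policy: given the plays made so far (most recent first), it draws
either the next subsequence to be played (`Sum.inl S`), or the decision to stop and to declare an
arm as its prediction of the best arm (`Sum.inr i`). -/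
abbrev Policy (n : ℕ) : Type := List (Play n) → PMF (Finset (Fin n) ⊕ Fin n)

/-- State of the game: the plays made so far (most recent first), and the declared arm if the
agent has stopped. -/
structure State (n : ℕ) where
  history : List (Play n)
  declared : Option (Fin n)

instance (n : ℕ) : MeasurableSpace (State n) := ⊤

/-- One step of the game. Nothing changes once the agent has stopped. -/
def step {n : ℕ} (μ : Means n) (π : Policy n) : State n → PMF (State n)
  | ⟨h, some i⟩ => PMF.pure ⟨h, some i⟩
  | ⟨h, none⟩ => (π h).bind fun
      | Sum.inl S => (feedback μ S).map fun f => ⟨(S, f) :: h, none⟩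
      | Sum.inr i => PMF.pure ⟨h, some i⟩

/-- The transition kernel of the game, from the trajectory up to time `m` to the next state. -/
def stepKernel {n : ℕ} (μ : Means n) (π : Policy n) (m : ℕ) :
    Kernel (Finset.Iic m → State n) (State n) where
  toFun x := (step μ π (x ⟨m, Finset.mem_Iic.2 le_rfl⟩)).toMeasure
  measurable' :=
    (measurable_from_top (f := fun s : State n => (step μ π s).toMeasure)).comp
      (measurable_pi_apply _)

instance {n : ℕ} (μ : Means n) (π : Policy n) (m : ℕ) : IsMarkovKernel (stepKernel μ π m) :=
  ⟨fun _ => PMF.toMeasure.isProbabilityMeasure _⟩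

/-- The law of the whole game (the sequence of its states) under the mean rewards `μ` and the
policy `π`, started with no plays made. -/
def law {n : ℕ} (μ : Means n) (π : Policy n) : Measure (ℕ → State n) :=
  Kernel.trajMeasure (X := fun _ => State n) (Measure.dirac ⟨[], none⟩) (stepKernel μ π)

/-- The total number of plays `T` (infinite if the agent plays forever). -/
def numPlays {n : ℕ} (ω : ℕ → State n) : ℕ∞ := ⨆ m, ((ω m).history.length : ℕ∞)

/-- The expected number of plays `E[T]`. -/
def expectedPlays {n : ℕ} (μ : Means n) (π : Policy n) : ℝ≥0∞ :=
  ∫⁻ ω, (numPlays ω : ℝ≥0∞) ∂(law μ π)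

/-- The event that the agent stops and declares arm `i`. -/
def declares {n : ℕ} (i : Fin n) : Set (ℕ → State n) := {ω | ∃ m, (ω m).declared = some i}

/-- Arm `i` is the (unique) best arm. -/
def IsBestArm {n : ℕ} (μ : Means n) (i : Fin n) : Prop := ∀ j, j ≠ i → μ j < μ i

/-- The policy identifies the best arm with probability at least `1 - δ` for all mean rewards in
`[0, 1]^n` that have a best arm. -/
def IdentifiesBestArm {n : ℕ} (π : Policy n) (δ : ℝ) : Prop :=
  ∀ (μ : Means n) (i : Fin n), IsBestArm μ i →
    ENNReal.ofReal (1 - δ) ≤ law μ π (declares i)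

/-- The gap `Δ_i = μ^* - μ_i` of arm `i`, where `b` is the best arm. -/
def gap {n : ℕ} (μ : Means n) (b i : Fin n) : ℝ := (μ b : ℝ) - μ i

/-- The smallest gap `Δ = min_{i ≠ b} Δ_i`, where `b` is the best arm. -/
def minGap {n : ℕ} (μ : Means n) (b : Fin n) : ℝ := ⨅ i : {i : Fin n // i ≠ b}, gap μ b i

end LinkedBandit

end

namespace LinkedBandit

/-! Fix a suboptimal arm `i` and raise its mean, and no other, slightly above `μ b`. Arm `i` is then
the best, so the policy must declare `i` instead of `b` with probability at least `1 - δ`. Only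
observations of `i` can distinguish the two instances, and each carries information of order at most
`gap μ b i ^ 2`. Hence `i` is observed at least of order `log (1 / δ) / gap μ b i ^ 2` times in
expectation (`eventually_le_mul_stepsExp_obsCount`).

Observations become plays in two ways. A play reveals at most one reward `1`, so the sum over `i` of
`μ i` times the expected number of observations of `i` is at most the expected number of plays
(`sum_stepsExp_obsCount_le`); this gives the sum over arms. A play also observes each arm at most
once; applied to an arm of smallest gap, together with `μ b + ∏ i, (1 - μ i) ≤ 2`, this gives the
last term.

The argument runs at a finite horizon `k`, where expectations are finite recursions (`stepsExp`) and
no integrability is needed. The change of measure (`exp_stepsExp_le`) uses no likelihood ratios: it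
propagates an exponential inequality through the steps by Jensen. -/

/-! ### Expectations under a probability mass function -/

/-- Integration against a `PMF` on a discrete measurable space is a weighted sum. -/
lemma lintegral_toMeasure_eq_tsum {α : Type*} [MeasurableSpace α] [DiscreteMeasurableSpace α]
    (p : PMF α) (g : α → ℝ≥0∞) : ∫⁻ a, g a ∂p.toMeasure = ∑' a, p a * g a := by
  have h : p.toMeasure = Measure.sum fun a => p a • Measure.dirac a := by
    ext s hs
    rw [PMF.toMeasure_apply _ hs, Measure.sum_apply _ hs]
    refine tsum_congr fun a => ?_
    by_cases ha : a ∈ s <;> simp [ha]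
  rw [h, lintegral_sum_measure]
  refine tsum_congr fun a => ?_
  rw [lintegral_smul_measure, lintegral_dirac' _ (.of_discrete), smul_eq_mul]

lemma tsum_pure_mul {α : Type*} (a : α) (g : α → ℝ≥0∞) :
    ∑' x, PMF.pure a x * g x = g a := by
  rw [tsum_eq_single a fun x hx => by simp [hx]]
  simp

lemma tsum_bind_mul {α β : Type*} (p : PMF α) (q : α → PMF β) (g : β → ℝ≥0∞) :
    ∑' b, p.bind q b * g b = ∑' a, p a * ∑' b, q a b * g b := by
  simp_rw [PMF.bind_apply, ← ENNReal.tsum_mul_right, ← ENNReal.tsum_mul_left]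
  rw [ENNReal.tsum_comm]
  simp_rw [mul_assoc]

lemma tsum_map_mul {α β : Type*} (p : PMF α) (f : α → β) (g : β → ℝ≥0∞) :
    ∑' b, p.map f b * g b = ∑' a, p a * g (f a) := by
  rw [PMF.map, tsum_bind_mul]
  simp_rw [Function.comp_apply, tsum_pure_mul]

variable {n : ℕ}

instance : DiscreteMeasurableSpace (State n) := ⟨fun _ => trivial⟩

/-! ### Expectation operators of one play and of one step -/

/-- Expectation of a function of the feedback when the given list of arms is played. -/
noncomputable def playExp (μ : Means n) : List (Fin n) → (List Bool → ℝ) → ℝ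
  | [], g => g []
  | i :: l, g => (μ i : ℝ) * g [true] + (1 - (μ i : ℝ)) * playExp μ l fun f => g (false :: f)

/-- Expectation of a function of the state after one step of the game. -/
noncomputable def stepExp (μ : Means n) (π : Policy n) (G : State n → ℝ) : State n → ℝ
  | ⟨h, some i⟩ => G ⟨h, some i⟩
  | ⟨h, none⟩ => ∑ S, (π h (Sum.inl S)).toReal *
        playExp μ (S.sort (· ≤ ·)) (fun f => G ⟨(S, f) :: h, none⟩)
      + ∑ i, (π h (Sum.inr i)).toReal * G ⟨h, some i⟩

lemma playExp_mono (μ : Means n) (l : List (Fin n)) {g g' : List Bool → ℝ}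
    (h : ∀ f, g f ≤ g' f) : playExp μ l g ≤ playExp μ l g' := by
  induction l generalizing g g' with
  | nil => exact h _
  | cons i l ih =>
    exact add_le_add (mul_le_mul_of_nonneg_left (h _) (μ i).2.1)
      (mul_le_mul_of_nonneg_left (ih fun f => h _) (sub_nonneg.2 (μ i).2.2))

lemma playExp_const (μ : Means n) (l : List (Fin n)) (c : ℝ) :
    playExp μ l (fun _ => c) = c := by
  induction l with
  | nil => rfl
  | cons i l ih => rw [playExp, ih]; ring

lemma playExp_add (μ : Means n) (l : List (Fin n)) (g g' : List Bool → ℝ) :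
    playExp μ l (fun f => g f + g' f) = playExp μ l g + playExp μ l g' := by
  induction l generalizing g g' with
  | nil => rfl
  | cons i l ih => rw [playExp, playExp, playExp, ih]; ring

lemma playExp_const_mul (μ : Means n) (l : List (Fin n)) (c : ℝ) (g : List Bool → ℝ) :
    playExp μ l (fun f => c * g f) = c * playExp μ l g := by
  induction l generalizing g with
  | nil => rfl
  | cons i l ih => rw [playExp, playExp, ih]; ring

lemma stepExp_mono (μ : Means n) (π : Policy n) {G G' : State n → ℝ} (h : ∀ s, G s ≤ G' s)
    (s : State n) : stepExp μ π G s ≤ stepExp μ π G' s := by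
  obtain ⟨hs, _ | i⟩ := s
  · exact add_le_add
      (Finset.sum_le_sum fun S _ =>
        mul_le_mul_of_nonneg_left (playExp_mono _ _ fun f => h _) ENNReal.toReal_nonneg)
      (Finset.sum_le_sum fun i _ => mul_le_mul_of_nonneg_left (h _) ENNReal.toReal_nonneg)
  · exact h _

lemma stepExp_add (μ : Means n) (π : Policy n) (G G' : State n → ℝ) :
    stepExp μ π (fun s => G s + G' s) = fun s => stepExp μ π G s + stepExp μ π G' s := by
  funext ⟨hs, d⟩
  cases d with
  | none =>
    simp only [stepExp, playExp_add, mul_add, Finset.sum_add_distrib]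
    ring
  | some i => rfl

lemma stepExp_const_mul (μ : Means n) (π : Policy n) (c : ℝ) (G : State n → ℝ) :
    stepExp μ π (fun s => c * G s) = fun s => c * stepExp μ π G s := by
  funext ⟨hs, d⟩
  cases d with
  | none =>
    simp only [stepExp, playExp_const_mul, mul_add, Finset.mul_sum]
    congr 1 <;> exact Finset.sum_congr rfl fun _ _ => by ring
  | some i => rfl

lemma sum_policy_eq_one (π : Policy n) (h : List (Play n)) :
    ∑ S, (π h (Sum.inl S)).toReal + ∑ i, (π h (Sum.inr i)).toReal = 1 := by
  rw [← Fintype.sum_sum_type fun x => (π h x).toReal,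
    ← ENNReal.toReal_sum fun a _ => PMF.apply_ne_top _ _, ← tsum_fintype (L := .unconditional _),
    PMF.tsum_coe, ENNReal.toReal_one]

lemma stepExp_const (μ : Means n) (π : Policy n) (c : ℝ) :
    stepExp μ π (fun _ => c) = fun _ => c := by
  funext ⟨hs, d⟩
  cases d with
  | none =>
    simp only [stepExp, playExp_const]
    rw [← Finset.sum_mul, ← Finset.sum_mul, ← add_mul, sum_policy_eq_one, one_mul]
  | some i => rfl

/-- Expectation of a function of the state after `k` steps of the game. -/
noncomputable def stepsExp (μ : Means n) (π : Policy n) (k : ℕ) (G : State n → ℝ) : ℝ :=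
  (stepExp μ π)^[k] G ⟨[], none⟩

lemma iterate_stepExp_mono (μ : Means n) (π : Policy n) (k : ℕ) {G G' : State n → ℝ}
    (h : ∀ s, G s ≤ G' s) (s : State n) :
    (stepExp μ π)^[k] G s ≤ (stepExp μ π)^[k] G' s := by
  induction k generalizing G G' with
  | zero => exact h s
  | succ k ih => exact ih (stepExp_mono μ π h)

lemma stepsExp_mono (μ : Means n) (π : Policy n) (k : ℕ) {G G' : State n → ℝ}
    (h : ∀ s, G s ≤ G' s) : stepsExp μ π k G ≤ stepsExp μ π k G' :=
  iterate_stepExp_mono μ π k h _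

lemma stepsExp_add (μ : Means n) (π : Policy n) (k : ℕ) (G G' : State n → ℝ) :
    stepsExp μ π k (fun s => G s + G' s) = stepsExp μ π k G + stepsExp μ π k G' := by
  unfold stepsExp
  induction k generalizing G G' with
  | zero => rfl
  | succ k ih =>
    rw [Function.iterate_succ_apply, stepExp_add]
    exact ih _ _

lemma stepsExp_const_mul (μ : Means n) (π : Policy n) (k : ℕ) (c : ℝ) (G : State n → ℝ) :
    stepsExp μ π k (fun s => c * G s) = c * stepsExp μ π k G := by
  unfold stepsExp
  induction k generalizing G with
  | zero => rfl
  | succ k ih =>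
    rw [Function.iterate_succ_apply, stepExp_const_mul]
    exact ih _

lemma stepsExp_const (μ : Means n) (π : Policy n) (k : ℕ) (c : ℝ) :
    stepsExp μ π k (fun _ => c) = c := by
  unfold stepsExp
  induction k with
  | zero => rfl
  | succ k ih => rw [Function.iterate_succ_apply, stepExp_const]; exact ih

lemma stepsExp_nonneg (μ : Means n) (π : Policy n) (k : ℕ) {G : State n → ℝ}
    (h : ∀ s, 0 ≤ G s) : 0 ≤ stepsExp μ π k G :=
  (stepsExp_const μ π k 0).symm.le.trans (stepsExp_mono μ π k h)

lemma stepsExp_sum (μ : Means n) (π : Policy n) (k : ℕ) {ι : Type*} (s : Finset ι)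
    (G : ι → State n → ℝ) :
    stepsExp μ π k (fun x => ∑ i ∈ s, G i x) = ∑ i ∈ s, stepsExp μ π k (G i) := by
  classical
  induction s using Finset.induction_on with
  | empty => simpa using stepsExp_const μ π k 0
  | insert i s hi ih => simp_rw [Finset.sum_insert hi, stepsExp_add, ih]

/-! ### The expectation operators compute expectations under the law of the game -/

lemma reward_true (q : unitInterval) : reward q true = ENNReal.ofReal q := by
  rw [reward, Measure.toPMF_apply,
    bernoulliMeasure_apply_of_mem_of_notMem _ (by simp) (by simp) (by simp)]
  rw [ENNReal.ofReal_eq_coe_nnreal q.2.1]; rfl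

lemma reward_false (q : unitInterval) : reward q false = ENNReal.ofReal (1 - q) := by
  rw [reward, Measure.toPMF_apply,
    bernoulliMeasure_apply_of_notMem_of_mem _ (by simp) (by simp) (by simp)]
  rw [ENNReal.ofReal_eq_coe_nnreal (sub_nonneg.2 q.2.2)]; rfl

lemma playExp_nonneg (μ : Means n) (l : List (Fin n)) {g : List Bool → ℝ}
    (h : ∀ f, 0 ≤ g f) : 0 ≤ playExp μ l g :=
  (playExp_const μ l 0).symm.le.trans (playExp_mono μ l h)

lemma tsum_rewards_mul (μ : Means n) (l : List (Fin n)) {g : List Bool → ℝ} (hg : ∀ f, 0 ≤ g f) :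
    ∑' x, rewards μ l x * ENNReal.ofReal (g (revealed x)) = ENNReal.ofReal (playExp μ l g) := by
  induction l generalizing g with
  | nil => simp only [rewards, tsum_pure_mul, revealed, playExp]
  | cons i l ih =>
    have h1 : (0 : ℝ) ≤ 1 - (μ i : ℝ) := sub_nonneg.2 (μ i).2.2
    rw [rewards, tsum_bind_mul, tsum_bool, reward_true, reward_false, tsum_map_mul, tsum_map_mul]
    simp only [revealed]
    rw [ih fun f => hg _, ENNReal.tsum_mul_right, PMF.tsum_coe, one_mul, playExp,
      ← ENNReal.ofReal_mul h1, ← ENNReal.ofReal_mul (μ i).2.1, ← ENNReal.ofReal_add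
        (mul_nonneg h1 (playExp_nonneg _ _ fun f => hg _)) (mul_nonneg (μ i).2.1 (hg _)), add_comm]

lemma tsum_feedback_mul (μ : Means n) (S : Finset (Fin n)) {g : List Bool → ℝ}
    (hg : ∀ f, 0 ≤ g f) : ∑' x, feedback μ S x * ENNReal.ofReal (g x)
      = ENNReal.ofReal (playExp μ (S.sort (· ≤ ·)) g) := by
  rw [feedback, tsum_map_mul, tsum_rewards_mul μ _ hg]

lemma stepExp_nonneg (μ : Means n) (π : Policy n) {G : State n → ℝ} (hG : ∀ s, 0 ≤ G s)
    (s : State n) : 0 ≤ stepExp μ π G s :=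
  (congrFun (stepExp_const μ π 0) s).symm.le.trans (stepExp_mono μ π hG s)

lemma lintegral_step (μ : Means n) (π : Policy n) {G : State n → ℝ} (hG : ∀ s, 0 ≤ G s)
    (s : State n) :
    ∫⁻ x, ENNReal.ofReal (G x) ∂(step μ π s).toMeasure = ENNReal.ofReal (stepExp μ π G s) := by
  rw [lintegral_toMeasure_eq_tsum]
  obtain ⟨h, _ | i⟩ := s
  · rw [step, tsum_bind_mul, tsum_fintype, Fintype.sum_sum_type]
    simp only [tsum_map_mul, tsum_pure_mul, stepExp]
    have h1 : ∀ S, 0 ≤ (π h (Sum.inl S)).toReal *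
        playExp μ (S.sort (· ≤ ·)) (fun f => G ⟨(S, f) :: h, none⟩) := fun S =>
      mul_nonneg ENNReal.toReal_nonneg (playExp_nonneg _ _ fun f => hG _)
    have h2 : ∀ i, 0 ≤ (π h (Sum.inr i)).toReal * G ⟨h, some i⟩ := fun i =>
      mul_nonneg ENNReal.toReal_nonneg (hG _)
    rw [ENNReal.ofReal_add (Finset.sum_nonneg fun S _ => h1 S) (Finset.sum_nonneg fun i _ => h2 i),
      ENNReal.ofReal_sum_of_nonneg fun S _ => h1 S, ENNReal.ofReal_sum_of_nonneg fun i _ => h2 i]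
    congr 1
    · refine Finset.sum_congr rfl fun S _ => ?_
      rw [tsum_feedback_mul μ S (g := fun f => G ⟨(S, f) :: h, none⟩) fun f => hG _,
        ENNReal.ofReal_mul ENNReal.toReal_nonneg, ENNReal.ofReal_toReal (PMF.apply_ne_top _ _)]
    · refine Finset.sum_congr rfl fun S _ => ?_
      rw [ENNReal.ofReal_mul ENNReal.toReal_nonneg, ENNReal.ofReal_toReal (PMF.apply_ne_top _ _)]
  · rw [step, tsum_pure_mul, stepExp]

instance (μ : Means n) (π : Policy n) : IsProbabilityMeasure (law μ π) := by
  unfold law; infer_instance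

lemma measurable_step (μ : Means n) (π : Policy n) (F : State n × State n → ℝ≥0∞) :
    Measurable fun s => ∫⁻ x, F (s, x) ∂(step μ π s).toMeasure := measurable_from_top

/-- The Markov property: conditionally on the state at time `m`, the next state is distributed
according to `step`. -/
lemma lintegral_law_succ (μ : Means n) (π : Policy n) (m : ℕ) {F : State n × State n → ℝ≥0∞}
    (hF : Measurable F) : ∫⁻ ω, F (ω m, ω (m + 1)) ∂law μ π
      = ∫⁻ ω, ∫⁻ x, F (ω m, x) ∂(step μ π (ω m)).toMeasure ∂law μ π := by
  have h := Kernel.map_frestrictLe_trajMeasure_compProd_eq_map_trajMeasure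
    (X := fun _ => State n) (μ₀ := Measure.dirac ⟨[], none⟩) (κ := stepKernel μ π) (a := m)
  let g : (Finset.Iic m → State n) × State n → State n × State n :=
    fun x => (x.1 ⟨m, Finset.mem_Iic.2 le_rfl⟩, x.2)
  have hg : Measurable g := by fun_prop
  have h' := congrArg (fun ρ => ∫⁻ x, (F ∘ g) x ∂ρ) h
  beta_reduce at h'
  rw [Measure.lintegral_compProd (hF.comp hg), lintegral_map _ (by fun_prop),
    lintegral_map (hF.comp hg) (by fun_prop)] at h'
  · exact h'.symm
  · exact ((measurable_step μ π F).comp (measurable_pi_apply _))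

lemma law_map_zero (μ : Means n) (π : Policy n) :
    (law μ π).map (fun ω => ω 0) = Measure.dirac ⟨[], none⟩ := by
  have h0 : (fun ω : ℕ → State n => ω 0) = (fun x : Finset.Iic 0 → State n =>
      x ⟨0, Finset.mem_Iic.2 le_rfl⟩) ∘ Preorder.frestrictLe 0 := rfl
  rw [h0, ← Measure.map_map (by fun_prop) (by fun_prop), law, Kernel.trajMeasure,
    Measure.map_comp _ _ (by fun_prop), Kernel.traj_map_frestrictLe, Kernel.partialTraj_self,
    Measure.id_comp, Measure.map_map (by fun_prop) (by fun_prop)]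
  exact Measure.map_id

/-- The Markov property peels off the last step, replacing `G` at time `k + 1` by `stepExp μ π G` at
time `k`. -/
lemma lintegral_law (μ : Means n) (π : Policy n) (k : ℕ) {G : State n → ℝ} (hG : ∀ s, 0 ≤ G s) :
    ∫⁻ ω, ENNReal.ofReal (G (ω k)) ∂law μ π = ENNReal.ofReal (stepsExp μ π k G) := by
  induction k generalizing G with
  | zero =>
    have := lintegral_map (μ := law μ π) (g := fun ω => ω 0)
      (f := fun s => ENNReal.ofReal (G s)) measurable_from_top (by fun_prop)
    rw [← this, law_map_zero, lintegral_dirac' _ measurable_from_top]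
    rfl
  | succ k ih =>
    have hm : Measurable fun s => ENNReal.ofReal (G s) := measurable_from_top
    rw [lintegral_law_succ μ π k (F := fun x => ENNReal.ofReal (G x.2)) (hm.comp measurable_snd)]
    simp_rw [lintegral_step μ π hG]
    rw [ih (stepExp_nonneg μ π hG)]
    rfl

/-! ### The declared arm -/

/-- Indicator of the states in which arm `i` has been declared. -/
noncomputable def declInd (i : Fin n) (s : State n) : ℝ := if s.declared = some i then 1 else 0

lemma declInd_nonneg (i : Fin n) (s : State n) : 0 ≤ declInd i s := by
  unfold declInd; split_ifs <;> norm_num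

lemma law_declared_at (μ : Means n) (π : Policy n) (i : Fin n) (k : ℕ) :
    law μ π {ω | (ω k).declared = some i} = ENNReal.ofReal (stepsExp μ π k (declInd i)) := by
  have hs : MeasurableSet {ω : ℕ → State n | (ω k).declared = some i} :=
    (measurable_pi_apply (X := fun _ => State n) k)
      (MeasurableSet.of_discrete (s := {s : State n | s.declared = some i}))
  rw [← lintegral_law μ π k (declInd_nonneg i), ← lintegral_indicator_one hs]
  refine lintegral_congr fun ω => ?_
  by_cases h : (ω k).declared = some i <;> simp [declInd, h]

lemma ae_declared_succ (μ : Means n) (π : Policy n) (i : Fin n) :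
    ∀ᵐ ω ∂law μ π, ∀ k, (ω k).declared = some i → (ω (k + 1)).declared = some i := by
  rw [ae_all_iff]
  intro k
  let B : Set (State n × State n) :=
    {s | s.declared = some i} ×ˢ {s | s.declared ≠ some i}
  have hB : MeasurableSet B := .prod .of_discrete .of_discrete
  have h := lintegral_law_succ μ π k (F := B.indicator 1) (measurable_const.indicator hB)
  have h0 : ∀ s : State n, ∫⁻ x, B.indicator 1 (s, x) ∂(step μ π s).toMeasure = 0 := by
    intro s
    rw [lintegral_toMeasure_eq_tsum]
    obtain ⟨hs, _ | j⟩ := s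
    · simp [B, Set.indicator]
    · rw [step, tsum_pure_mul]
      simp [B, Set.indicator]
  simp_rw [h0, lintegral_zero] at h
  have hm : Measurable fun ω : ℕ → State n =>
      B.indicator (1 : State n × State n → ℝ≥0∞) (ω k, ω (k + 1)) :=
    (measurable_const.indicator hB).comp (by fun_prop)
  rw [lintegral_eq_zero_iff hm] at h
  filter_upwards [h] with ω hω h1
  by_contra h2
  have : ((ω k, ω (k + 1)) : State n × State n) ∈ B := ⟨h1, h2⟩
  simp [this] at hω

/-- Declarations are irrevocable only almost surely, so the events at time `k` are increasing up to
null sets; continuity from below is applied to their accumulated unions. -/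
lemma tendsto_stepsExp_declInd (μ : Means n) (π : Policy n) (i : Fin n) :
    Filter.Tendsto (fun k => stepsExp μ π k (declInd i)) Filter.atTop
      (nhds (law μ π (declares i)).toReal) := by
  let A : ℕ → Set (ℕ → State n) := fun k => {ω | (ω k).declared = some i}
  have hU : declares i = ⋃ k, A k := by ext ω; simp [declares, A]
  have hacc : ∀ k, law μ π (Set.accumulate A k) = law μ π (A k) := by
    intro k
    refine measure_congr ?_
    filter_upwards [ae_declared_succ μ π i] with ω hω
    refine propext ⟨fun h => ?_, fun h => Set.subset_accumulate h⟩
    obtain ⟨m, hm, h⟩ := Set.mem_accumulate.1 h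
    exact Nat.le_induction h (fun j _ hj => hω j hj) k hm
  have ht := tendsto_measure_iUnion_accumulate (μ := law μ π) (f := A)
  rw [← hU] at ht
  simp_rw [hacc, A, law_declared_at] at ht
  have := (ENNReal.tendsto_toReal (measure_ne_top (law μ π) _)).comp ht
  refine this.congr fun k => ?_
  rw [Function.comp_apply, ENNReal.toReal_ofReal (stepsExp_nonneg μ π k (declInd_nonneg i))]

/-! ### Number of observations of an arm -/

/-- Number of observations of arm `i` in the plays made so far. -/
def obsCount (i : Fin n) (h : List (Play n)) : ℕ :=
  (h.map fun x => ((x.1.sort (· ≤ ·)).take x.2.length).count i).sum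

lemma obsCount_cons (i : Fin n) (S : Finset (Fin n)) (f : List Bool) (h : List (Play n)) :
    obsCount i ((S, f) :: h)
      = ((S.sort (· ≤ ·)).take f.length).count i + obsCount i h := by
  simp [obsCount]

lemma obsCount_le_length (i : Fin n) (h : List (Play n)) : obsCount i h ≤ h.length := by
  induction h with
  | nil => simp [obsCount]
  | cons x h ih =>
    obtain ⟨S, f⟩ := x
    rw [obsCount_cons, List.length_cons, add_comm]
    refine add_le_add ih ?_
    -- The sorted list of a finite set has no repetition, so one play observes an arm at most once.
    exact List.nodup_iff_count_le_one.1 ((S.sort_nodup _).sublist (List.take_sublist _ _)) i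

/-- In one play, the expected total mean reward of the observed arms is at most `1`, as at most one
reward `1` is observed. -/
lemma playExp_sum_count_le_one (μ : Means n) (l : List (Fin n)) :
    playExp μ l (fun f => ∑ i, (μ i : ℝ) * ((l.take f.length).count i : ℝ)) ≤ 1 := by
  induction l with
  | nil => simp [playExp]
  | cons j l ih =>
    have h : ∀ m : ℕ, ∑ i, (μ i : ℝ) * (((j :: l).take (m + 1)).count i : ℝ)
        = μ j + ∑ i, (μ i : ℝ) * ((l.take m).count i : ℝ) := by
      intro m
      simp [List.count_cons, mul_add, Finset.sum_add_distrib, add_comm]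
    simp only [playExp, List.length_cons, h, playExp_add, playExp_const]
    have h0 := (μ j).2.1
    have h1 := sub_nonneg.2 (μ j).2.2
    simp only [List.length_nil, List.take_zero, List.count_nil, Nat.cast_zero, mul_zero,
      Finset.sum_const_zero]
    -- The head contributes `μ j`, and the tail is reached only with probability `1 - μ j`: `μ j +
    -- (1 - μ j) * 1 = 1`.
    nlinarith [mul_le_mul_of_nonneg_left ih h1]

/-- Number of plays minus the total mean reward of the observed arms. -/
noncomputable def playSurplus (μ : Means n) (s : State n) : ℝ :=
  s.history.length + (-1) * ∑ i, (μ i : ℝ) * (obsCount i s.history : ℝ)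

/-- The submartingale property under `μ`: a play adds `1` and subtracts at most `1` in expectation.
-/
lemma playSurplus_le_stepExp (μ : Means n) (π : Policy n) (s : State n) :
    playSurplus μ s ≤ stepExp μ π (playSurplus μ) s := by
  obtain ⟨h, _ | i⟩ := s
  · have key : ∀ S : Finset (Fin n), playSurplus μ ⟨h, none⟩
        ≤ playExp μ (S.sort (· ≤ ·)) fun f => playSurplus μ ⟨(S, f) :: h, none⟩ := by
      intro S
      have h1 : (fun f => playSurplus μ ⟨(S, f) :: h, none⟩) = fun f =>
          (playSurplus μ ⟨h, none⟩ + 1) + (-1) *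
            ∑ i, (μ i : ℝ) * (((S.sort (· ≤ ·)).take f.length).count i : ℝ) := by
        funext f
        simp only [playSurplus, obsCount_cons, List.length_cons, Nat.cast_add, mul_add,
          Finset.sum_add_distrib, Nat.cast_one]
        ring
      rw [h1, playExp_add, playExp_const, playExp_const_mul]
      linarith [playExp_sum_count_le_one μ (S.sort (· ≤ ·))]
    calc playSurplus μ ⟨h, none⟩
        = stepExp μ π (fun _ => playSurplus μ ⟨h, none⟩) ⟨h, none⟩ := by rw [stepExp_const]
      _ ≤ _ := by
        simp only [stepExp, playExp_const]
        exact add_le_add (Finset.sum_le_sum fun S _ =>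
          mul_le_mul_of_nonneg_left (key S) ENNReal.toReal_nonneg) le_rfl
  · exact le_rfl

lemma sum_stepsExp_obsCount_le (μ : Means n) (π : Policy n) (k : ℕ) :
    ∑ i, (μ i : ℝ) * stepsExp μ π k (fun s => (obsCount i s.history : ℝ))
      ≤ stepsExp μ π k fun s => (s.history.length : ℝ) := by
  have h : ∀ k s, playSurplus μ s ≤ (stepExp μ π)^[k] (playSurplus μ) s := by
    intro k
    induction k with
    | zero => exact fun s => le_rfl
    | succ k ih =>
      intro s
      exact (ih s).trans (iterate_stepExp_mono μ π k (playSurplus_le_stepExp μ π) s)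
  have h0 : 0 ≤ stepsExp μ π k (playSurplus μ) := by
    refine le_trans ?_ (h k ⟨[], none⟩)
    simp [playSurplus, obsCount]
  have h1 := stepsExp_add μ π k (fun s => (s.history.length : ℝ))
    (fun s => (-1) * ∑ i, (μ i : ℝ) * (obsCount i s.history : ℝ))
  rw [stepsExp_const_mul, stepsExp_sum] at h1
  simp_rw [stepsExp_const_mul] at h1
  change stepsExp μ π k (playSurplus μ) = _ at h1
  linarith

lemma stepsExp_obsCount_le (μ : Means n) (π : Policy n) (k : ℕ) (i : Fin n) :
    stepsExp μ π k (fun s => (obsCount i s.history : ℝ))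
      ≤ stepsExp μ π k fun s => (s.history.length : ℝ) :=
  stepsExp_mono μ π k fun s => Nat.cast_le.2 (obsCount_le_length i s.history)

lemma stepsExp_length_le_expectedPlays (μ : Means n) (π : Policy n) (k : ℕ) :
    ENNReal.ofReal (stepsExp μ π k fun s => (s.history.length : ℝ)) ≤ expectedPlays μ π := by
  rw [← lintegral_law μ π k fun s => Nat.cast_nonneg _]
  refine lintegral_mono fun ω => ?_
  rw [ENNReal.ofReal_natCast]
  have h : ((ω k).history.length : ℕ∞) ≤ numPlays ω :=
    le_iSup (fun m => ((ω m).history.length : ℕ∞)) k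
  simpa using ENat.toENNReal_le.2 h

/-! ### Change of measure -/

/-- Change of measure between two Bernoulli rewards, with cost the `χ²`-divergence. -/
lemma exp_bernoulli_le {p q : ℝ} (hp0 : 0 ≤ p) (hp1 : p ≤ 1) (hq0 : 0 < q) (hq1 : q < 1)
    (u v : ℝ) : Real.exp (p * u + (1 - p) * v - (p - q) ^ 2 / (q * (1 - q)))
      ≤ q * Real.exp u + (1 - q) * Real.exp v := by
  -- The linear shift `x / y - 1` replaces the logarithm of the likelihood ratio, so `p = 0` and `p
  -- = 1` need no separate treatment; its mean under `p` is the `χ²`-divergence.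
  have aux : ∀ {x y : ℝ} (z : ℝ), 0 < y →
      x * Real.exp (z - (x / y - 1)) ≤ y * Real.exp z := by
    intro x y z hy
    have h1 : x / y ≤ Real.exp (x / y - 1) := by linarith [Real.add_one_le_exp (x / y - 1)]
    rw [Real.exp_sub, ← mul_div_assoc, div_le_iff₀ (Real.exp_pos _)]
    calc x * Real.exp z = x / y * (y * Real.exp z) := by field_simp
      _ ≤ Real.exp (x / y - 1) * (y * Real.exp z) := by gcongr
      _ = _ := by ring
  have hq1' : 0 < 1 - q := sub_pos.2 hq1
  have hj := convexOn_exp.2 (Set.mem_univ (u - (p / q - 1)))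
    (Set.mem_univ (v - ((1 - p) / (1 - q) - 1))) hp0 (sub_nonneg.2 hp1) (by ring)
  simp only [smul_eq_mul] at hj
  have he : p * (u - (p / q - 1)) + (1 - p) * (v - ((1 - p) / (1 - q) - 1))
      = p * u + (1 - p) * v - (p - q) ^ 2 / (q * (1 - q)) := by
    field_simp
    ring
  rw [he] at hj
  exact hj.trans (add_le_add (aux u hq0) (aux v hq1'))

lemma exp_convex_bernoulli_le (q : unitInterval) (u v : ℝ) :
    Real.exp (q * u + (1 - q) * v) ≤ q * Real.exp u + (1 - q) * Real.exp v :=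
  convexOn_exp.2 (Set.mem_univ u) (Set.mem_univ v) q.2.1 (sub_nonneg.2 q.2.2) (by ring)

section ChangeOfMeasure

variable {μ ν : Means n} {i : Fin n} {D : ℝ}

/-- The cost `D` is paid exactly when arm `i` is observed. The other arms have the same law under
both means, so plain convexity of `exp` suffices there. -/
lemma exp_playExp_le
    (hD : ∀ u v : ℝ, Real.exp (μ i * u + (1 - μ i) * v - D)
      ≤ ν i * Real.exp u + (1 - ν i) * Real.exp v)
    (hν : ∀ j, j ≠ i → ν j = μ j) (l : List (Fin n)) {u w : List Bool → ℝ}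
    (h : ∀ f, Real.exp (u f + D * ((l.take f.length).count i : ℝ)) ≤ w f) :
    Real.exp (playExp μ l u) ≤ playExp ν l w := by
  induction l generalizing u w with
  | nil => simpa [playExp] using h []
  | cons j l ih =>
    have h1 := h [true]
    -- An observation of the head is moved from the count into `u`, since the induction hypothesis
    -- counts in the tail only.
    have h0 := ih (u := fun f => u (false :: f) + D * (if j = i then 1 else 0))
      (w := fun f => w (false :: f)) (by
        intro f
        refine le_trans (le_of_eq ?_) (h (false :: f))
        by_cases hji : j = i <;> simp [hji]; ring_nf)
    rw [playExp_add, playExp_const] at h0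
    simp only [playExp]
    refine le_trans ?_ (add_le_add (mul_le_mul_of_nonneg_left h1 (ν j).2.1)
      (mul_le_mul_of_nonneg_left h0 (sub_nonneg.2 (ν j).2.2)))
    by_cases hji : j = i
    · subst hji
      refine le_trans (le_of_eq ?_) (hD _ _)
      simp
      ring
    · rw [hν j hji]
      refine le_trans (le_of_eq ?_) (exp_convex_bernoulli_le (μ j) _ _)
      simp [hji]

/-- The policy's randomization is the same under `μ` and `ν`, so Jensen handles it at no cost. Past
observations enter as a constant, leaving only those of the new play to `exp_playExp_le`. -/
lemma exp_stepExp_le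
    (hD : ∀ u v : ℝ, Real.exp (μ i * u + (1 - μ i) * v - D)
      ≤ ν i * Real.exp u + (1 - ν i) * Real.exp v)
    (hν : ∀ j, j ≠ i → ν j = μ j) (π : Policy n) {U W : State n → ℝ}
    (h : ∀ s, Real.exp (U s + D * obsCount i s.history) ≤ W s) (s : State n) :
    Real.exp (stepExp μ π U s + D * obsCount i s.history) ≤ stepExp ν π W s := by
  obtain ⟨hs, _ | j⟩ := s
  · set c : ℝ := D * obsCount i hs with hc
    have h1 : stepExp μ π U ⟨hs, none⟩ + c = stepExp μ π (fun s => U s + c) ⟨hs, none⟩ := by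
      rw [stepExp_add, stepExp_const]
    have h2 : ∀ S : Finset (Fin n),
        Real.exp (playExp μ (S.sort (· ≤ ·)) fun f => U ⟨(S, f) :: hs, none⟩ + c)
          ≤ playExp ν (S.sort (· ≤ ·)) fun f => W ⟨(S, f) :: hs, none⟩ := by
      intro S
      refine exp_playExp_le hD hν _ fun f => ?_
      refine le_trans (le_of_eq ?_) (h ⟨(S, f) :: hs, none⟩)
      rw [obsCount_cons, hc]
      push_cast
      ring_nf
    have hJ := convexOn_exp.map_sum_le (t := Finset.univ)
      (w := fun x : Finset (Fin n) ⊕ Fin n => (π hs x).toReal)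
      (p := Sum.elim (fun S => playExp μ (S.sort (· ≤ ·)) fun f => U ⟨(S, f) :: hs, none⟩ + c)
        (fun j => U ⟨hs, some j⟩ + c))
      (fun _ _ => ENNReal.toReal_nonneg)
      (by rw [Fintype.sum_sum_type]; exact sum_policy_eq_one π hs) (fun _ _ => Set.mem_univ _)
    simp only [Fintype.sum_sum_type, Sum.elim_inl, Sum.elim_inr, smul_eq_mul] at hJ
    change Real.exp (_ + c) ≤ _
    rw [h1]
    refine hJ.trans (add_le_add ?_ ?_)
    · exact Finset.sum_le_sum fun S _ =>
        mul_le_mul_of_nonneg_left (h2 S) ENNReal.toReal_nonneg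
    · exact Finset.sum_le_sum fun j _ =>
        mul_le_mul_of_nonneg_left (h ⟨hs, some j⟩) ENNReal.toReal_nonneg
  · exact h _

/-- Change of measure for the first `k` steps of the game, when the two mean vectors differ in
arm `i` only. -/
lemma exp_stepsExp_le
    (hD : ∀ u v : ℝ, Real.exp (μ i * u + (1 - μ i) * v - D)
      ≤ ν i * Real.exp u + (1 - ν i) * Real.exp v)
    (hν : ∀ j, j ≠ i → ν j = μ j) (π : Policy n) (k : ℕ) {U W : State n → ℝ}
    (h : ∀ s, Real.exp (U s + D * obsCount i s.history) ≤ W s) :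
    Real.exp (stepsExp μ π k U) ≤ stepsExp ν π k W := by
  have key : ∀ s, Real.exp ((stepExp μ π)^[k] U s + D * obsCount i s.history)
      ≤ (stepExp ν π)^[k] W s := by
    induction k generalizing U W with
    | zero => exact h
    | succ k ih => exact ih (exp_stepExp_le hD hν π h)
  simpa [obsCount, stepsExp] using key ⟨[], none⟩

/-- A Donsker–Varadhan bound for the event that `b` is declared by time `k`, with free exponent `t`.
-/
lemma mul_stepsExp_declInd_sub_le
    (hD : ∀ u v : ℝ, Real.exp (μ i * u + (1 - μ i) * v - D)
      ≤ ν i * Real.exp u + (1 - ν i) * Real.exp v)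
    (hν : ∀ j, j ≠ i → ν j = μ j) (π : Policy n) (k : ℕ) (b : Fin n) (t : ℝ) :
    t * stepsExp μ π k (declInd b) - D * stepsExp μ π k (fun s => (obsCount i s.history : ℝ))
      ≤ Real.log (1 + (Real.exp t - 1) * stepsExp ν π k (declInd b)) := by
  have h := exp_stepsExp_le hD hν π k
    (U := fun s => t * declInd b s + (-D) * (obsCount i s.history : ℝ))
    (W := fun s => 1 + (Real.exp t - 1) * declInd b s) (by
      intro s
      by_cases hs : s.declared = some b <;> simp [declInd, hs])
  rw [stepsExp_add, stepsExp_add, stepsExp_const_mul, stepsExp_const_mul, stepsExp_const_mul,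
    stepsExp_const] at h
  rw [Real.le_log_iff_exp_le ((Real.exp_pos _).trans_le h), sub_eq_add_neg, ← neg_mul]
  exact h

end ChangeOfMeasure

/-! ### The lower bound -/

lemma stepsExp_declInd_add_le_one (μ : Means n) (π : Policy n) (k : ℕ) {i b : Fin n}
    (hib : i ≠ b) : stepsExp μ π k (declInd b) + stepsExp μ π k (declInd i) ≤ 1 := by
  rw [← stepsExp_add, ← stepsExp_const μ π k 1]
  refine stepsExp_mono μ π k fun s => ?_
  by_cases hb : s.declared = some b
  · simp [declInd, hb, hib.symm]
  · by_cases hi : s.declared = some i <;> simp [declInd, hb, hi, hib]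

/-- If `α, β` are at least `1 - δ`, then the bound from the change of measure with the optimal
exponent is at least the binary relative entropy of `1 - δ` and `δ`. -/
lemma binary_entropy_le {δ α β : ℝ} (h0 : 0 < δ) (h1 : δ < 1 / 2) (hα : 1 - δ ≤ α)
    (hβ : 1 - δ ≤ β) (hβ1 : β ≤ 1) :
    (1 - 2 * δ) * Real.log ((1 - δ) / δ) ≤ 2 * Real.log ((1 - δ) / δ) * α
      - Real.log (1 + (((1 - δ) / δ) ^ 2 - 1) * (1 - β)) := by
  have hx : 1 < (1 - δ) / δ := by rw [lt_div_iff₀ h0]; linarith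
  have hlog : 0 < Real.log ((1 - δ) / δ) := Real.log_pos hx
  have hx2 : 0 ≤ ((1 - δ) / δ) ^ 2 - 1 := by nlinarith
  have h2 : Real.log (1 + (((1 - δ) / δ) ^ 2 - 1) * (1 - β)) ≤ Real.log ((1 - δ) / δ) := by
    apply Real.log_le_log
    · nlinarith [mul_nonneg hx2 (sub_nonneg.2 hβ1)]
    · calc 1 + (((1 - δ) / δ) ^ 2 - 1) * (1 - β) ≤ 1 + (((1 - δ) / δ) ^ 2 - 1) * δ := by
            gcongr; linarith
        -- With `x = (1 - δ) / δ`, one has `1 + (x ^ 2 - 1) * δ = x`; the final bound is then `2 *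
        -- (1 - δ) * log x - log x`.
        _ = (1 - δ) / δ := by field_simp; ring
  nlinarith [mul_le_mul_of_nonneg_left hα hlog.le]

/-- Each suboptimal arm is observed often, eventually in the number of steps of the game. -/
lemma eventually_le_mul_stepsExp_obsCount {p₀ δ : ℝ} (hp₀ : 0 < p₀) (h0 : 0 < δ) (h1 : δ < 1 / 2)
    {π : Policy n} (hπ : IdentifiesBestArm π δ) {μ : Means n} {b i : Fin n}
    (hb : IsBestArm μ b) (hib : i ≠ b) (hl : p₀ ≤ μ b) (hu : (μ b : ℝ) ≤ 1 - p₀) :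
    ∀ᶠ k in Filter.atTop, (1 - 2 * δ) * Real.log ((1 - δ) / δ) / 2
      ≤ 8 * gap μ b i ^ 2 / p₀ ^ 2 * stepsExp μ π k (fun s => (obsCount i s.history : ℝ)) := by
  have hgap : 0 < gap μ b i := sub_pos.2 (hb i hib)
  have hε : 0 < min (gap μ b i) (p₀ / 2) := lt_min hgap (by linarith)
  have hε1 := min_le_left (gap μ b i) (p₀ / 2)
  have hε2 := min_le_right (gap μ b i) (p₀ / 2)
  -- The new mean of arm `i`. The bound by the gap gives `q - μ i ≤ 2 * gap μ b i`; the bound by `p₀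
  -- / 2` keeps `q ≥ p₀` and `1 - q ≥ p₀ / 2`, so the variance `q * (1 - q)` is at least `p₀ ^ 2 /
  -- 2`.
  obtain ⟨q, hq⟩ : ∃ q, q = (μ b : ℝ) + min (gap μ b i) (p₀ / 2) := ⟨_, rfl⟩
  have hqmem : q ∈ unitInterval := ⟨by linarith, by linarith⟩
  let ν : Means n := Function.update μ i ⟨q, hqmem⟩
  have hνi : (ν i : ℝ) = q := by simp [ν]
  have hν : ∀ j, j ≠ i → ν j = μ j := fun j hj => by simp [ν, hj]
  have hbest : IsBestArm ν i := by
    intro j hj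
    rw [hν j hj, ← Subtype.coe_lt_coe, hνi]
    have : (μ j : ℝ) ≤ μ b := by
      rcases eq_or_ne j b with rfl | hjb
      · exact le_rfl
      · exact (hb j hjb).le
    linarith
  have hq0 : 0 < q := by linarith
  have hq1 : 0 < 1 - q := by linarith
  have hDle : ((μ i : ℝ) - q) ^ 2 / (q * (1 - q)) ≤ 8 * gap μ b i ^ 2 / p₀ ^ 2 := by
    have ha : ((μ i : ℝ) - q) ^ 2 ≤ 4 * gap μ b i ^ 2 := by
      have : q - μ i ≤ 2 * gap μ b i := by unfold gap at *; linarith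
      have : 0 ≤ q - μ i := by unfold gap at *; linarith
      nlinarith
    have hc : p₀ ^ 2 / 2 ≤ q * (1 - q) := by nlinarith
    calc _ ≤ 4 * gap μ b i ^ 2 / (p₀ ^ 2 / 2) := by gcongr
      _ = _ := by ring
  have hD : ∀ u v : ℝ, Real.exp (μ i * u + (1 - μ i) * v - 8 * gap μ b i ^ 2 / p₀ ^ 2)
      ≤ ν i * Real.exp u + (1 - ν i) * Real.exp v := by
    intro u v
    rw [hνi]
    refine le_trans (Real.exp_le_exp.2 ?_)
      (exp_bernoulli_le (μ i).2.1 (μ i).2.2 hq0 (sub_pos.1 hq1) u v)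
    linarith
  have hx : 1 < (1 - δ) / δ := by rw [lt_div_iff₀ h0]; linarith
  have hlog : 0 < Real.log ((1 - δ) / δ) := Real.log_pos hx
  have hx2 : 0 ≤ ((1 - δ) / δ) ^ 2 - 1 := by nlinarith
  have hexp : Real.exp (2 * Real.log ((1 - δ) / δ)) = ((1 - δ) / δ) ^ 2 := by
    rw [mul_comm, Real.exp_mul, Real.exp_log (by linarith)]
    exact_mod_cast rfl
  have hge : ∀ (ρ : Means n) (a : Fin n), IsBestArm ρ a →
      1 - δ ≤ (law ρ π (declares a)).toReal := fun ρ a ha =>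
    (ENNReal.ofReal_le_iff_le_toReal (measure_ne_top _ _)).1 (hπ ρ a ha)
  have hle1 : (law ν π (declares i)).toReal ≤ 1 :=
    ENNReal.toReal_le_of_le_ofReal zero_le_one (by simpa using prob_le_one)
  have hα := tendsto_stepsExp_declInd μ π b
  have hβ := tendsto_stepsExp_declInd ν π i
  have hlim := (hα.const_mul (2 * Real.log ((1 - δ) / δ))).sub
    ((((hβ.const_sub 1).const_mul (((1 - δ) / δ) ^ 2 - 1)).const_add 1).log
      (by nlinarith [mul_nonneg hx2 (sub_nonneg.2 hle1)]))
  have hK := binary_entropy_le h0 h1 (hge μ b hb) (hge ν i hbest) hle1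
  have hKpos : 0 < (1 - 2 * δ) * Real.log ((1 - δ) / δ) := mul_pos (by linarith) hlog
  -- The limit is at least the entropy bound, which is positive; giving up half of it yields the
  -- inequality at finite times.
  filter_upwards [hlim.eventually_const_lt
    (u := (1 - 2 * δ) * Real.log ((1 - δ) / δ) / 2) (by linarith)] with k hk
  have hcm := mul_stepsExp_declInd_sub_le hD hν π k b (2 * Real.log ((1 - δ) / δ))
  rw [hexp] at hcm
  -- Declaring `b` and declaring `i` exclude each other, so success under `ν` makes declaring `b`
  -- unlikely.
  have hsum := stepsExp_declInd_add_le_one ν π k hib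
  have hmono : Real.log (1 + (((1 - δ) / δ) ^ 2 - 1) * stepsExp ν π k (declInd b))
      ≤ Real.log (1 + (((1 - δ) / δ) ^ 2 - 1) * (1 - stepsExp ν π k (declInd i))) := by
    apply Real.log_le_log
    · nlinarith [mul_nonneg hx2 (stepsExp_nonneg ν π k (declInd_nonneg b))]
    · gcongr; linarith
  linarith

lemma exists_mul_log_le {δ₀ : ℝ} (h0 : 0 < δ₀) (h1 : δ₀ < 1 / 2) :
    ∃ κ : ℝ, 0 < κ ∧ ∀ δ, 0 < δ → δ ≤ δ₀ →
      κ * Real.log (1 / δ) ≤ (1 - 2 * δ) * Real.log ((1 - δ) / δ) := by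
  have hL0 : Real.log δ₀ < 0 := Real.log_neg h0 (by linarith)
  have hM0 : Real.log δ₀ < Real.log (1 - δ₀) := Real.log_lt_log h0 (by linarith)
  have hr : Real.log (1 - δ₀) / Real.log δ₀ < 1 := (div_lt_one_of_neg hL0).2 hM0
  have hM1 : Real.log (1 - δ₀) ≤ 0 := Real.log_nonpos (by linarith) (by linarith)
  have hr0 : 0 ≤ Real.log (1 - δ₀) / Real.log δ₀ := div_nonneg_of_nonpos hM1 hL0.le
  -- With `r = log (1 - δ₀) / log δ₀`, which lies in `[0, 1)`, `r * log δ ≤ log (1 - δ₀) ≤ log (1 -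
  -- δ)`, so `log ((1 - δ) / δ) ≥ (1 - r) * log (1 / δ)`.
  refine ⟨(1 - 2 * δ₀) * (1 - Real.log (1 - δ₀) / Real.log δ₀),
    mul_pos (by linarith) (by linarith), fun δ hδ hδδ₀ => ?_⟩
  have hL : Real.log δ ≤ Real.log δ₀ := Real.log_le_log hδ hδδ₀
  have hM : Real.log (1 - δ₀) ≤ Real.log (1 - δ) := Real.log_le_log (by linarith) (by linarith)
  have hlog : 0 ≤ Real.log ((1 - δ) / δ) :=
    Real.log_nonneg (by rw [le_div_iff₀ hδ]; linarith)
  rw [one_div, Real.log_inv, mul_assoc]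
  refine mul_le_mul (by linarith) ?_ (mul_nonneg (by linarith) (by linarith)) (by linarith)
  rw [Real.log_div (by linarith) hδ.ne']
  have h2 : Real.log (1 - δ₀) / Real.log δ₀ * Real.log δ ≤ Real.log (1 - δ₀) := by
    calc _ ≤ Real.log (1 - δ₀) / Real.log δ₀ * Real.log δ₀ := by gcongr
      _ = _ := div_mul_cancel₀ _ hL0.ne
  linarith

lemma exists_minGap_eq (hn : 2 ≤ n) (μ : Means n) (b : Fin n) :
    ∃ i, i ≠ b ∧ gap μ b i = minGap μ b := by
  have : Nontrivial (Fin n) := Fin.nontrivial_iff_two_le.2 hn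
  obtain ⟨j, hj⟩ := exists_ne b
  have : Nonempty {i : Fin n // i ≠ b} := ⟨⟨j, hj⟩⟩
  obtain ⟨i, hi⟩ := exists_eq_ciInf_of_finite (f := fun i : {i : Fin n // i ≠ b} => gap μ b i)
  exact ⟨i, i.2, hi⟩

end LinkedBandit

open LinkedBandit in
theorem mainTheorem2 (p₀ δ₀ : ℝ) (hp₀ : 0 < p₀) (hδ₀ : δ₀ < 1 / 2) :
    ∃ c : ℝ, 0 < c ∧
      ∀ (n : ℕ), 2 ≤ n → ∀ (δ : ℝ), 0 < δ → δ ≤ δ₀ →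
      ∀ (π : LinkedBandit.Policy n), LinkedBandit.IdentifiesBestArm π δ →
      ∀ (μ : LinkedBandit.Means n) (b : Fin n), LinkedBandit.IsBestArm μ b →
        p₀ ≤ (μ b : ℝ) → (μ b : ℝ) ≤ 1 - p₀ →
        ENNReal.ofReal
            (c * (∑ i ∈ Finset.univ.erase b, (μ i : ℝ) / LinkedBandit.gap μ b i ^ 2
                + ((μ b : ℝ) + ∏ i, (1 - (μ i : ℝ))) / LinkedBandit.minGap μ b ^ 2)
              * Real.log (1 / δ))
          ≤ LinkedBandit.expectedPlays μ π := by
  rcases le_or_gt δ₀ 0 with hδ0 | hδ0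
  · exact ⟨1, one_pos, fun n _ δ h h' => absurd (h.trans_le h') (not_lt.2 hδ0)⟩
  obtain ⟨κ, hκ, hκle⟩ := exists_mul_log_le hδ0 hδ₀
  -- `48 = 8 * 2 * 3`: `8` from the divergence bound, `2` from the finite horizon, `3` from adding
  -- the bounds `E` and `2 * E` at the end.
  refine ⟨p₀ ^ 2 * κ / 48, by positivity, fun n hn δ h0 hδ π hπ μ b hb hl hu => ?_⟩
  have h1 : δ < 1 / 2 := hδ.trans_lt hδ₀
  -- There are finitely many arms, so one horizon `k` serves them all.
  have hev : ∀ᶠ k in Filter.atTop, ∀ i, i ≠ b → (1 - 2 * δ) * Real.log ((1 - δ) / δ) / 2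
      ≤ 8 * gap μ b i ^ 2 / p₀ ^ 2 * stepsExp μ π k (fun s => (obsCount i s.history : ℝ)) := by
    rw [Filter.eventually_all]
    intro i
    by_cases hib : i = b
    · exact .of_forall fun k h => absurd hib h
    · filter_upwards [eventually_le_mul_stepsExp_obsCount hp₀ h0 h1 hπ hb hib hl hu]
        with k hk _ using hk
  obtain ⟨k, hk⟩ := hev.exists
  refine le_trans (ENNReal.ofReal_le_ofReal ?_) (stepsExp_length_le_expectedPlays μ π k)
  set E := stepsExp μ π k fun s => (s.history.length : ℝ)
  set N : Fin n → ℝ := fun i => stepsExp μ π k fun s => (obsCount i s.history : ℝ)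
  have hN0 : ∀ i, 0 ≤ N i := fun i => stepsExp_nonneg μ π k fun s => Nat.cast_nonneg _
  set M := p₀ ^ 2 * κ / 16 * Real.log (1 / δ) with hM
  have hM0 : 0 ≤ M := mul_nonneg (by positivity)
    (Real.log_nonneg (by rw [le_div_iff₀ h0]; linarith))
  have hobs : ∀ i, i ≠ b → M / gap μ b i ^ 2 ≤ N i := by
    intro i hi
    have hg : 0 < gap μ b i := sub_pos.2 (hb i hi)
    have h2 := hκle δ h0 hδ
    have h3 : κ * Real.log (1 / δ) / 2 ≤ 8 * gap μ b i ^ 2 / p₀ ^ 2 * N i :=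
      le_trans (by linarith) (hk i hi)
    rw [div_le_iff₀ (by positivity)]
    calc M = p₀ ^ 2 / 8 * (κ * Real.log (1 / δ) / 2) := by rw [hM]; ring
      _ ≤ p₀ ^ 2 / 8 * (8 * gap μ b i ^ 2 / p₀ ^ 2 * N i) := by gcongr
      _ = N i * gap μ b i ^ 2 := by field_simp
  have hsum : M * ∑ i ∈ Finset.univ.erase b, (μ i : ℝ) / gap μ b i ^ 2 ≤ E := by
    refine le_trans ?_ (sum_stepsExp_obsCount_le μ π k)
    rw [Finset.mul_sum]
    refine le_trans (Finset.sum_le_sum fun i hi => ?_) (Finset.sum_le_sum_of_subset_of_nonneg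
      (Finset.erase_subset b _) fun i _ _ => mul_nonneg (μ i).2.1 (hN0 i))
    calc M * ((μ i : ℝ) / gap μ b i ^ 2) = μ i * (M / gap μ b i ^ 2) := by ring
      _ ≤ μ i * N i := mul_le_mul_of_nonneg_left (hobs i (Finset.ne_of_mem_erase hi)) (μ i).2.1
  obtain ⟨j, hj, hjgap⟩ := exists_minGap_eq hn μ b
  have hmin : M / minGap μ b ^ 2 ≤ E :=
    hjgap ▸ (hobs j hj).trans (stepsExp_obsCount_le μ π k j)
  have hprod : ∏ i, (1 - (μ i : ℝ)) ≤ 1 :=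
    Finset.prod_le_one (fun i _ => sub_nonneg.2 (μ i).2.2) fun i _ => by linarith [(μ i).2.1]
  have hlast : M * (((μ b : ℝ) + ∏ i, (1 - (μ i : ℝ))) / minGap μ b ^ 2) ≤ 2 * E := by
    calc _ = ((μ b : ℝ) + ∏ i, (1 - (μ i : ℝ))) * (M / minGap μ b ^ 2) := by ring
      _ ≤ 2 * (M / minGap μ b ^ 2) := by
        gcongr
        linarith [(μ b).2.2]
      _ ≤ 2 * E := by linarith
  calc _ = (M * ∑ i ∈ Finset.univ.erase b, (μ i : ℝ) / gap μ b i ^ 2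
        + M * (((μ b : ℝ) + ∏ i, (1 - (μ i : ℝ))) / minGap μ b ^ 2)) / 3 := by rw [hM]; ring
    _ ≤ E := by linarith
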